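/- Let $\mathbb S^3$ be the 6-dimensional space of complex symmetric $3\times 3$ matrices, where $M\in\mathbb S^3$ is identified with the conic $(x,y,z)\,M\,(x,y,z)^T$, and let $\mathbb P^5=\mathbb P(\mathbb S^3)$. A net of conics is a 3-dimensional linear subspace $\mathcal L\subset\mathbb S^3$. Two nets $\mathcal L_1,\mathcal L_2$ are congruent if $\mathcal L_2=g^T\mathcal L_1 g$ for some $g\in \mathrm{GL}_3(\mathbb C)$. A net $\mathcal L$ is of type $A$ if its discriminant, the cubic curve $\{\det=0\}\subset\mathbb P\mathcal L$, is smooth; of type $B^*$ if it is congruent to the span of $y^2+2xz,\ 2yz,\ -x^2-2y^2+2xz$; of type $D^*$ if it is congruent to the span of $2xz,\ 2yz,\ z^2+2xy$; and of type $E^*$ if it is congruent to the span of $2xz,\ 2yz,\ 2xy$. The reciprocal surface $\mathbb P\mathcal L^{-1}\subset\mathbb P^5$ is the Zariski closure of $\{[A^{-1}] : A\in\mathcal L,\ \det A\neq 0\}$. The Veronese surface in $\mathbb P^5$ is the image of $\mathbb P^2\to\mathbb P^5$, $(\alpha:\beta:\gamma)\mapsto [vv^T]$ with $v=(\alpha,\beta,\gamma)^T$.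 Theorem 3.2. For every net of conics $\mathcal L$ of type $A$, $B^*$, $D^*$ or $E^*$, the reciprocal surface $\mathbb P\mathcal L^{-1}$ is projectively equivalent to the Veronese surface, that is, some projective linear automorphism of $\mathbb P^5$ maps $\mathbb P\mathcal L^{-1}$ onto the Veronese surface. -/

import Mathlib

namespace NetsOfConics

open scoped LinearAlgebra.Projectivization

/-- The space of complex symmetric `3 × 3` matrices, i.e. of conics: `M` is identified with the
quadratic form `(x, y, z) M (x, y, z)ᵀ`. -/
def Sym3 : Submodule ℂ (Matrix (Fin 3) (Fin 3) ℂ) where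
  carrier := {M | M.IsSymm}
  add_mem' hM hN := hM.add hN
  zero_mem' := Matrix.isSymm_zero
  smul_mem' a _ hM := hM.smul a

/-- The projective space of symmetric matrices, which is `ℙ⁵`. -/
abbrev ProjSym3 : Type := ℙ ℂ Sym3

/-- The symmetric matrix of the conic `a x² + b y² + c z² + 2 d xy + 2 e xz + 2 f yz`. -/
def conic (a b c d e f : ℂ) : Sym3 :=
  ⟨!![a, d, e; d, b, f; e, f, c], by
    change Matrix.IsSymm _
    ext i j
    fin_cases i <;> fin_cases j <;> rfl⟩

/-! ### Zariski closure in `ℙ⁵` -/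

/-- The polynomial `f` in the matrix entries vanishes at (every representative of) the point `p`. -/
def VanishesAt (f : MvPolynomial (Fin 3 × Fin 3) ℂ) (p : ProjSym3) : Prop :=
  ∀ (M : Sym3) (hM : M ≠ 0), p = Projectivization.mk ℂ M hM →
    MvPolynomial.eval (fun ij : Fin 3 × Fin 3 => (M : Matrix (Fin 3) (Fin 3) ℂ) ij.1 ij.2) f = 0

/-- Zariski closed subsets of `ℙ⁵`: the common zero loci of sets of homogeneous polynomials. -/
def IsZariskiClosed (Z : Set ProjSym3) : Prop :=
  ∃ F : Set (MvPolynomial (Fin 3 × Fin 3) ℂ),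
    (∀ f ∈ F, ∃ d : ℕ, f.IsHomogeneous d) ∧ Z = {p | ∀ f ∈ F, VanishesAt f p}

/-- The Zariski closure: the intersection of all Zariski closed sets containing `X`. -/
def zariskiClosure (X : Set ProjSym3) : Set ProjSym3 :=
  ⋂₀ {Z | IsZariskiClosed Z ∧ X ⊆ Z}

/-! ### Reciprocal surface, Veronese surface, projective equivalence -/

/-- The set of points `[A⁻¹]`, where `A` runs over the invertible matrices in `L`. -/
def inverseLocus (L : Submodule ℂ Sym3) : Set ProjSym3 :=
  {p | ∃ A ∈ L, (A : Matrix (Fin 3) (Fin 3) ℂ).det ≠ 0 ∧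
    ∃ (B : Sym3) (hB : B ≠ 0),
      (B : Matrix (Fin 3) (Fin 3) ℂ) = (A : Matrix (Fin 3) (Fin 3) ℂ)⁻¹ ∧
      p = Projectivization.mk ℂ B hB}

/-- The reciprocal surface of `L`. -/
def reciprocalSurface (L : Submodule ℂ Sym3) : Set ProjSym3 :=
  zariskiClosure (inverseLocus L)

/-- The Veronese surface: the image of `(α : β : γ) ↦ (α, β, γ)ᵀ (α, β, γ)`. -/
def veroneseSurface : Set ProjSym3 :=
  {p | ∃ α β γ : ℂ, (α ≠ 0 ∨ β ≠ 0 ∨ γ ≠ 0) ∧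
    ∃ h : conic (α ^ 2) (β ^ 2) (γ ^ 2) (α * β) (α * γ) (β * γ) ≠ 0,
      p = Projectivization.mk ℂ (conic (α ^ 2) (β ^ 2) (γ ^ 2) (α * β) (α * γ) (β * γ)) h}

/-- Two subsets of `ℙ⁵` are projectively equivalent if a projective linear automorphism of `ℙ⁵`
maps the first onto the second. -/
def ProjectivelyEquivalent (X Y : Set ProjSym3) : Prop :=
  ∃ T : Sym3 ≃ₗ[ℂ] Sym3, Projectivization.map T.toLinearMap T.injective '' X = Y

/-! ### Nets of conics and their types -/

/-- A net of conics: a three-dimensional linear space of symmetric matrices. -/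
def IsNet (L : Submodule ℂ Sym3) : Prop := Module.finrank ℂ L = 3

/-- The discriminant of `L`, the zero locus in `ℙ(L)` of the cubic form `det`, is smooth: at no
point of it do all the directional derivatives of `det` along `L` vanish. -/
def SmoothDiscriminant (L : Submodule ℂ Sym3) : Prop :=
  ∀ A ∈ L, A ≠ 0 → (A : Matrix (Fin 3) (Fin 3) ℂ).det = 0 →
    ∃ B ∈ L, deriv (fun t : ℂ => ((A + t • B : Sym3) : Matrix (Fin 3) (Fin 3) ℂ).det) 0 ≠ 0

/-- `L₂ = gᵀ L₁ g` for some invertible matrix `g`. -/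
def Congruent (L₁ L₂ : Submodule ℂ Sym3) : Prop :=
  ∃ g : GL (Fin 3) ℂ, ∀ M : Sym3, M ∈ L₂ ↔ ∃ N ∈ L₁, (M : Matrix (Fin 3) (Fin 3) ℂ) =
    (g : Matrix (Fin 3) (Fin 3) ℂ).transpose * (N : Matrix (Fin 3) (Fin 3) ℂ) *
      (g : Matrix (Fin 3) (Fin 3) ℂ)

/-- Type `A`: nets with smooth discriminant cubic. -/
def IsTypeA (L : Submodule ℂ Sym3) : Prop := IsNet L ∧ SmoothDiscriminant L

/-- Type `B*`: the congruence class of the net spanned by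
`y² + 2xz`, `2yz`, `-x² - 2y² + 2xz`. -/
def IsTypeBStar (L : Submodule ℂ Sym3) : Prop :=
  Congruent (Submodule.span ℂ
    {conic 0 1 0 0 1 0, conic 0 0 0 0 0 1, conic (-1) (-2) 0 0 1 0}) L

/-- Type `D*`: the congruence class of the net spanned by `2xz`, `2yz`, `z² + 2xy`. -/
def IsTypeDStar (L : Submodule ℂ Sym3) : Prop :=
  Congruent (Submodule.span ℂ
    {conic 0 0 0 0 1 0, conic 0 0 0 0 0 1, conic 0 0 1 1 0 0}) L

/-- Type `E*`: the congruence class of the net spanned by `2xz`, `2yz`, `2xy`. -/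
def IsTypeEStar (L : Submodule ℂ Sym3) : Prop :=
  Congruent (Submodule.span ℂ
    {conic 0 0 0 0 1 0, conic 0 0 0 0 0 1, conic 0 0 0 1 0 0}) L

end NetsOfConics

/-!
The map `A ↦ adj A` is quadratic, so on a net `L ≅ ℂ³` it is `v ↦ T (v vᵀ)` for a linear map `T` on
symmetric matrices. If the adjugates of the members of `L` span all symmetric matrices, then `T` is
an automorphism; the image of the Veronese surface under `T` is then closed, and it is the closure
of the set of inverses. For the types `B*`, `D*`, `E*` the adjugates are seen to span by writing
them down.

For type `A`, consider a linear form `φ` vanishing on all adjugates. If `A ∈ L` is singular with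
kernel spanned by `v`, then `adj A` is a nonzero multiple of `v vᵀ`, so the conic `φ (v vᵀ) = 0`
contains the Jacobian cubic of the net, which is the locus of these kernels. Smoothness of the
discriminant implies that of the Jacobian cubic, whose equation is therefore squarefree and, by the
Nullstellensatz, divides the equation of the conic. For degree reasons the latter is zero.
-/

namespace NetsOfConics

open Matrix
open scoped LinearAlgebra.Projectivization

section Polynomial

open MvPolynomial

variable {k σ : Type*} [Field k]

theorem eval_smul_of_isHomogeneous {R : Type*} [CommSemiring R] {f : MvPolynomial σ R} {d : ℕ}
    (hf : f.IsHomogeneous d) (c : R) (x : σ → R) : eval (c • x) f = c ^ d * eval x f := by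
  rw [eval_eq, eval_eq, Finset.mul_sum]
  refine Finset.sum_congr rfl fun m hm => ?_
  have hdeg : ∑ i ∈ m.support, m i = d := by
    simpa [Finsupp.weight_apply, Finsupp.sum] using hf (mem_support_iff.1 hm)
  simp only [Pi.smul_apply, smul_eq_mul, mul_pow, Finset.prod_mul_distrib,
    Finset.prod_pow_eq_pow_sum, hdeg]
  ring

theorem eq_zero_of_isHomogeneous_of_dvd {R : Type*} [CommRing R] [IsDomain R]
    {f g : MvPolynomial σ R} {m n : ℕ} (hf : f.IsHomogeneous m) (hg : g.IsHomogeneous n)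
    (hnm : n < m) (hdvd : f ∣ g) : g = 0 := by
  by_contra hg0
  obtain ⟨h, rfl⟩ := hdvd
  have hdeg := hg.totalDegree hg0
  rw [totalDegree_mul_of_isDomain (left_ne_zero_of_mul hg0) (right_ne_zero_of_mul hg0),
    hf.totalDegree (left_ne_zero_of_mul hg0)] at hdeg
  omega

variable [IsAlgClosed k] [Finite σ]

theorem exists_dvd_pow_of_forall_eval_eq_zero {f g : MvPolynomial σ k}
    (h : ∀ x, eval x f = 0 → eval x g = 0) : ∃ n : ℕ, f ∣ g ^ n := by
  have hg : g ∈ vanishingIdeal k (zeroLocus k (Ideal.span {f})) := by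
    simpa [mem_vanishingIdeal_iff, zeroLocus_span, aeval_eq_eval] using h
  rw [vanishingIdeal_zeroLocus_eq_radical] at hg
  obtain ⟨n, hn⟩ := hg
  exact ⟨n, Ideal.mem_span_singleton.1 hn⟩

theorem dvd_of_squarefree_of_forall_eval_eq_zero {f g : MvPolynomial σ k} (hf : Squarefree f)
    (h : ∀ x, eval x f = 0 → eval x g = 0) : f ∣ g := by
  obtain ⟨n, hn⟩ := exists_dvd_pow_of_forall_eval_eq_zero h
  exact (hf.dvd_pow_iff_dvd n.succ_ne_zero).1 (hn.trans (pow_dvd_pow g n.le_succ))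

theorem exists_ne_zero_eval_eq_zero [Nontrivial σ] {f : MvPolynomial σ k} (hf : ¬IsUnit f) :
    ∃ x ≠ 0, eval x f = 0 := by
  by_contra! hne
  have hX (i : σ) : ∃ n : ℕ, f ∣ X i ^ n := exists_dvd_pow_of_forall_eval_eq_zero fun x hx => by
    rw [not_imp_not.1 (hne x) hx, eval_X, Pi.zero_apply]
  obtain ⟨i, j, hij⟩ := exists_pair_ne σ
  obtain ⟨m, hm⟩ := hX i
  obtain ⟨n, hn⟩ := hX j
  have hrel : IsRelPrime (X i : MvPolynomial σ k) (X j) :=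
    (X_prime.irreducible.isRelPrime_iff_not_dvd).2 fun hdvd => hij (X_dvd_X.1 hdvd)
  exact hf (hrel.pow hm hn)

/-- A repeated factor would vanish at some nonzero point, at which `f` would be singular. -/
theorem squarefree_of_exists_pderiv_ne_zero [Nontrivial σ] {f : MvPolynomial σ k}
    (hf : ∀ x ≠ 0, eval x f = 0 → ∃ i, eval x (pderiv i f) ≠ 0) : Squarefree f := by
  rintro g ⟨h, rfl⟩
  by_contra hg
  obtain ⟨x, hx, hgx⟩ := exists_ne_zero_eval_eq_zero hg
  obtain ⟨i, hi⟩ := hf x hx (by simp [hgx])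
  exact hi (by simp [Derivation.leibniz, hgx])

end Polynomial

section Determinant

variable {n : Type*} [Fintype n] [DecidableEq n]

theorem derivation_prod {R A M ι : Type*} [CommSemiring R] [CommSemiring A] [AddCommMonoid M]
    [Algebra R A] [Module A M] [Module R M] [DecidableEq ι] (D : Derivation R A M) (s : Finset ι)
    (f : ι → A) : D (∏ i ∈ s, f i) = ∑ i ∈ s, (∏ j ∈ s.erase i, f j) • D (f i) := by
  induction s using Finset.induction_on with
  | empty => simp
  | insert a s ha ih =>
    rw [Finset.prod_insert ha, D.leibniz, ih, Finset.sum_insert ha, Finset.erase_insert ha,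
      Finset.smul_sum, add_comm]
    congr 1
    refine Finset.sum_congr rfl fun i hi => ?_
    have hai : a ≠ i := fun h => ha (h ▸ hi)
    rw [Finset.erase_insert_of_ne hai, Finset.prod_insert fun h => ha (Finset.mem_of_mem_erase h),
      smul_smul]

/-- Jacobi's formula. -/
theorem derivation_det {R A : Type*} [CommRing R] [CommRing A] [Algebra R A]
    (D : Derivation R A A) (M : Matrix n n A) : D M.det = (M.adjugate * M.map D).trace := by
  have hcol (i : n) : (M.adjugate * M.map D) i i = (M.updateCol i fun j => D (M j i)).det := by
    rw [← cramer_apply, cramer_eq_adjugate_mulVec]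
    rfl
  have hterm (τ : Equiv.Perm n) (i : n) :
      ∏ j, M.updateCol i (fun j => D (M j i)) (τ j) j =
        (∏ j ∈ Finset.univ.erase i, M (τ j) j) * D (M (τ i) i) := by
    rw [← Finset.prod_erase_mul _ _ (Finset.mem_univ i), updateCol_self]
    congr 1
    exact Finset.prod_congr rfl fun j hj => updateCol_ne (Finset.ne_of_mem_erase hj)
  simp only [trace, diag_apply, hcol, det_apply, hterm, map_sum, Units.smul_def, map_zsmul,
    derivation_prod, smul_eq_mul, Finset.smul_sum]
  exact Finset.sum_comm

/-- The matrix pencil `A + X B`, as a matrix of polynomials in the parameter. -/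
noncomputable def pencil {R : Type*} [CommSemiring R] (A B : Matrix n n R) :
    Matrix n n (Polynomial R) :=
  (Polynomial.X : Polynomial R) • B.map Polynomial.C + A.map Polynomial.C

theorem evalRingHom_mapMatrix_pencil {R : Type*} [CommSemiring R] (A B : Matrix n n R) (t : R) :
    (Polynomial.evalRingHom t).mapMatrix (pencil A B) = A + t • B := by
  ext i j
  simp [pencil, add_comm, mul_comm t]

theorem eval_det_pencil {R : Type*} [CommRing R] (A B : Matrix n n R) (t : R) :
    (pencil A B).det.eval t = (A + t • B).det := by
  rw [← evalRingHom_mapMatrix_pencil, ← RingHom.map_det, Polynomial.coe_evalRingHom]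

theorem eval_adjugate_pencil {R : Type*} [CommRing R] (A B : Matrix n n R) (t : R) (i j : n) :
    ((pencil A B).adjugate i j).eval t = (A + t • B).adjugate i j := by
  rw [← evalRingHom_mapMatrix_pencil, ← RingHom.map_adjugate]
  rfl

theorem det_pencil_ne_zero {R : Type*} [CommRing R] (A : Matrix n n R) {B : Matrix n n R}
    (hB : B.det ≠ 0) : (pencil A B).det ≠ 0 := fun h => hB <| by
  rw [← Polynomial.coeff_det_X_add_C_card B A, ← pencil, h, Polynomial.coeff_zero]

theorem deriv_det_add_smul {𝕜 : Type*} [NontriviallyNormedField 𝕜] (A B : Matrix n n 𝕜) :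
    deriv (fun t : 𝕜 => (A + t • B).det) 0 = (A.adjugate * B).trace := by
  have hderiv : (pencil A B).map Polynomial.derivative' = B.map Polynomial.C := by
    ext i j : 2
    simp [pencil]
  have htrace : (Polynomial.derivative (pencil A B).det).eval 0 = (A.adjugate * B).trace := by
    rw [← Polynomial.derivative'_apply, derivation_det, hderiv]
    simp [trace, mul_apply, Polynomial.eval_finsetSum, eval_adjugate_pencil]
  simp_rw [← eval_det_pencil, Polynomial.deriv, htrace]

/-- Since `det (A + t A₀)` is not identically zero in `t`, the polynomial
`t ↦ f (adj (A + t A₀))` vanishes identically. -/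
theorem eval_adjugate_eq_zero {k : Type*} [Field k] [Infinite k] {A A₀ : Matrix n n k}
    (hA₀ : A₀.det ≠ 0) (f : MvPolynomial (n × n) k)
    (hf : ∀ t : k, (A + t • A₀).det ≠ 0 →
      MvPolynomial.eval (fun ij => (A + t • A₀).adjugate ij.1 ij.2) f = 0) :
    MvPolynomial.eval (fun ij => A.adjugate ij.1 ij.2) f = 0 := by
  set q := MvPolynomial.eval₂ Polynomial.C (fun ij => (pencil A A₀).adjugate ij.1 ij.2) f
  have hq (t : k) :
      q.eval t = MvPolynomial.eval (fun ij => (A + t • A₀).adjugate ij.1 ij.2) f := by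
    simp_rw [← eval_adjugate_pencil]
    rw [← Polynomial.coe_evalRingHom, MvPolynomial.eval₂_comp_left, MvPolynomial.eval]
    congr 1
    ext; simp
  have hmul : q * (pencil A A₀).det = 0 := Polynomial.funext fun t => by
    rw [Polynomial.eval_mul, hq, eval_det_pencil, Polynomial.eval_zero, mul_eq_zero]
    exact or_iff_not_imp_right.2 (hf t)
  have hq0 := hq 0
  rwa [(mul_eq_zero.1 hmul).resolve_right (det_pencil_ne_zero A hA₀), Polynomial.eval_zero,
    zero_smul, add_zero, eq_comm] at hq0

end Determinant

section GenericMatrix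

open MvPolynomial

variable {R σ n : Type*} [CommRing R] [Fintype σ] [DecidableEq σ]

/-- A linear form on `σ → R`, as a polynomial in the coordinates. -/
noncomputable def linearPolynomial (l : (σ → R) →ₗ[R] R) : MvPolynomial σ R :=
  (LinearMap.toMatrix' (LinearMap.pi fun _ : Unit => l)).toMvPolynomial ()

theorem linearPolynomial_isHomogeneous (l : (σ → R) →ₗ[R] R) :
    (linearPolynomial l).IsHomogeneous 1 :=
  toMvPolynomial_isHomogeneous _ _

theorem eval_linearPolynomial (l : (σ → R) →ₗ[R] R) (x : σ → R) :
    eval x (linearPolynomial l) = l x := by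
  rw [linearPolynomial, toMvPolynomial_eval_eq_apply, LinearMap.toMatrix'_mulVec,
    LinearMap.pi_apply]

theorem pderiv_linearPolynomial (l : (σ → R) →ₗ[R] R) (i : σ) :
    pderiv i (linearPolynomial l) = C (l (Pi.single i 1)) := by
  simp [linearPolynomial, toMvPolynomial, monomial_eq, pderiv_X, Pi.single_apply,
    LinearMap.toMatrix'_apply]

/-- A linear family of matrices, as a single matrix of linear forms in the parameters. -/
noncomputable def genericMatrix (N : (σ → R) →ₗ[R] Matrix n n R) :
    Matrix n n (MvPolynomial σ R) :=
  of fun i j => linearPolynomial (Matrix.entryLinearMap R R i j ∘ₗ N)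

theorem eval_mapMatrix_genericMatrix [Fintype n] [DecidableEq n]
    (N : (σ → R) →ₗ[R] Matrix n n R) (x : σ → R) :
    (eval x).mapMatrix (genericMatrix N) = N x := by
  ext i j
  exact eval_linearPolynomial _ x

variable [Fintype n] [DecidableEq n]

theorem eval_det_genericMatrix (N : (σ → R) →ₗ[R] Matrix n n R) (x : σ → R) :
    eval x (genericMatrix N).det = (N x).det := by
  rw [RingHom.map_det, eval_mapMatrix_genericMatrix]

theorem det_genericMatrix_isHomogeneous (N : (σ → R) →ₗ[R] Matrix n n R) :
    (genericMatrix N).det.IsHomogeneous (Fintype.card n) := by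
  rw [det_apply]
  refine IsHomogeneous.sum _ _ _ fun τ _ => ?_
  have hprod : (∏ i, genericMatrix N (τ i) i).IsHomogeneous (Fintype.card n) := by
    simpa using IsHomogeneous.prod Finset.univ (fun i => genericMatrix N (τ i) i) (fun _ => 1)
      fun i _ => linearPolynomial_isHomogeneous _
  rcases Int.units_eq_one_or (Equiv.Perm.sign τ) with h | h
  · rwa [h, one_smul]
  · rw [h, Units.neg_smul, one_smul]
    exact hprod.neg

theorem eval_pderiv_det_genericMatrix (N : (σ → R) →ₗ[R] Matrix n n R) (x : σ → R) (i : σ) :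
    eval x (pderiv i (genericMatrix N).det) =
      ((N x).adjugate * N (Pi.single i 1)).trace := by
  have hderiv : (genericMatrix N).map (pderiv i) = (N (Pi.single i 1)).map C := by
    ext a b : 1
    exact pderiv_linearPolynomial (entryLinearMap R R a b ∘ₗ N) i
  rw [derivation_det, hderiv, AddMonoidHom.map_trace, ← eval_mapMatrix_genericMatrix N x,
    ← RingHom.map_adjugate]
  simp [trace, mul_apply]

end GenericMatrix

section Kernel

variable {K n : Type*} [Field K] [Fintype n] [DecidableEq n] {M : Matrix n n K} {v w : n → K}

/-- Both sides differ by the determinant of `M` with its row `k` replaced by the row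
`v i eⱼ - v j eᵢ`, a matrix that still annihilates `v`. -/
theorem mul_adjugate_eq_of_mulVec_eq_zero (hM : M *ᵥ v = 0) (i j k : n) :
    v i * M.adjugate j k = v j * M.adjugate i k := by
  rcases eq_or_ne v 0 with rfl | hv
  · simp
  have hdet : (M.updateRow k (v i • Pi.single j 1 - v j • Pi.single i 1)).det = 0 := by
    refine exists_mulVec_eq_zero_iff.1 ⟨v, hv, funext fun l => ?_⟩
    rcases eq_or_ne l k with rfl | hl
    · simp only [mulVec, updateRow_self, sub_dotProduct, smul_dotProduct, single_one_dotProduct,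
        smul_eq_mul, Pi.zero_apply, mul_comm, sub_self]
    · simpa [mulVec, updateRow_ne hl] using congrFun hM l
  rw [sub_eq_add_neg, ← neg_smul, det_updateRow_add, det_updateRow_smul, det_updateRow_smul,
    ← adjugate_apply, ← adjugate_apply, neg_mul, ← sub_eq_add_neg] at hdet
  exact sub_eq_zero.1 hdet

theorem exists_adjugate_eq_vecMulVec (hv : v ≠ 0) (hM : M *ᵥ v = 0) :
    ∃ r, M.adjugate = vecMulVec v r := by
  obtain ⟨i, hi⟩ := Function.ne_iff.1 hv
  refine ⟨fun k => M.adjugate i k / v i, ?_⟩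
  ext j k
  rw [vecMulVec_apply, mul_div_assoc', eq_div_iff hi, mul_comm,
    mul_adjugate_eq_of_mulVec_eq_zero hM]

theorem exists_eq_smul_of_mulVec_eq_zero (hM : M.adjugate ≠ 0) (hv : v ≠ 0) (hMv : M *ᵥ v = 0)
    (hMw : M *ᵥ w = 0) : ∃ c : K, w = c • v := by
  obtain ⟨r, hr⟩ := exists_adjugate_eq_vecMulVec hv hMv
  have hr0 : r ≠ 0 := fun h => hM (by rw [hr, h, vecMulVec_zero])
  obtain ⟨k, hk⟩ := Function.ne_iff.1 hr0
  obtain ⟨i, hi⟩ := Function.ne_iff.1 hv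
  refine ⟨w i / v i, funext fun j => ?_⟩
  have hcross := mul_adjugate_eq_of_mulVec_eq_zero hMw j i k
  simp only [hr, vecMulVec_apply, ← mul_assoc] at hcross
  rw [Pi.smul_apply, smul_eq_mul, div_mul_eq_mul_div, eq_div_iff hi, mul_right_cancel₀ hk hcross]

theorem exists_adjugate_eq_smul_vecMulVec (hM : M.IsSymm) (hv : v ≠ 0)
    (hMv : M *ᵥ v = 0) : ∃ c : K, M.adjugate = c • vecMulVec v v := by
  obtain ⟨r, hr⟩ := exists_adjugate_eq_vecMulVec hv hMv
  obtain ⟨i, hi⟩ := Function.ne_iff.1 hv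
  have hsymm (j k : n) : v j * r k = v k * r j := by
    simpa only [hr, vecMulVec_apply] using hM.adjugate.apply k j
  refine ⟨r i / v i, ?_⟩
  ext j k
  rw [hr, Matrix.smul_apply, vecMulVec_apply, vecMulVec_apply, smul_eq_mul, div_mul_eq_mul_div,
    eq_div_iff hi]
  linear_combination v j * hsymm i k

/-- Replace by `eᵢ` a row of `M` which is a combination of the others: the determinant of the new
matrix is an entry of the adjugate. -/
theorem exists_mulVec_eq_zero_of_adjugate_eq_zero (hM : M.adjugate = 0) (i : n) :
    ∃ x ≠ 0, M *ᵥ x = 0 ∧ x i = 0 := by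
  have hdet : M.det = 0 := by
    simpa [hM] using (congrFun₂ (mul_adjugate M) i i).symm
  obtain ⟨r, hr, hrM⟩ := exists_vecMul_eq_zero_iff.2 hdet
  obtain ⟨k, hk⟩ := Function.ne_iff.1 hr
  have hupdate : (M.updateRow k (Pi.single i 1)).det = 0 := by
    rw [← adjugate_apply, hM, Matrix.zero_apply]
  obtain ⟨x, hx, hMx⟩ := exists_mulVec_eq_zero_iff.2 hupdate
  have hrow (l : n) (hl : l ≠ k) : (M *ᵥ x) l = 0 := by
    simpa [mulVec, updateRow_ne hl] using congrFun hMx l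
  have hrowk : r k * (M *ᵥ x) k = 0 := by
    have hdot : r ⬝ᵥ M *ᵥ x = 0 := by rw [dotProduct_mulVec, hrM, zero_dotProduct]
    rwa [dotProduct, Finset.sum_eq_single k (fun l _ hl => by rw [hrow l hl, mul_zero])
      (by simp)] at hdot
  refine ⟨x, hx, funext fun l => ?_, by simpa [mulVec] using congrFun hMx k⟩
  rcases eq_or_ne l k with rfl | hl
  · exact (mul_eq_zero.1 hrowk).resolve_left hk
  · exact hrow l hl

end Kernel

section Quadratic

theorem exists_quadraticMap_add_smul_eq_zero {K V : Type*} [Field K] [IsAlgClosed K]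
    [AddCommGroup V] [Module K V] (Q : QuadraticForm K V) {x : V} (hx : Q x ≠ 0) (y : V) :
    ∃ s : K, Q (y + s • x) = 0 := by
  obtain ⟨s, hs⟩ := IsAlgClosed.exists_root
    (Polynomial.C (Q x) * Polynomial.X ^ 2 + Polynomial.C (QuadraticMap.polar Q y x) * Polynomial.X
      + Polynomial.C (Q y)) (by rw [Polynomial.degree_quadratic hx]; decide)
  refine ⟨s, ?_⟩
  simp only [Polynomial.IsRoot, Polynomial.eval_add, Polynomial.eval_mul, Polynomial.eval_C,
    Polynomial.eval_pow, Polynomial.eval_X] at hs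
  rw [QuadraticMap.map_add Q, QuadraticMap.map_smul, QuadraticMap.polar_smul_right, smul_eq_mul,
    smul_eq_mul]
  linear_combination hs

/-- Every quadratic map on `n → K` factors through `v ↦ v vᵀ`: this is the linear factor, which
reads off the matrix entries as coefficients of polar values. -/
noncomputable def veroneseLift {K n V : Type*} [Field K] [Fintype n] [DecidableEq n]
    [AddCommGroup V] [Module K V] (Q : QuadraticMap K (n → K) V) : Matrix n n K →ₗ[K] V :=
  (2⁻¹ : K) • ∑ i, ∑ j, (entryLinearMap K K i j).smulRight
    (QuadraticMap.polar Q (Pi.single i 1) (Pi.single j 1))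

theorem veroneseLift_vecMulVec {K n V : Type*} [Field K] [NeZero (2 : K)] [Fintype n]
    [DecidableEq n] [AddCommGroup V] [Module K V] (Q : QuadraticMap K (n → K) V) (v : n → K) :
    veroneseLift Q (vecMulVec v v) = Q v := by
  have hv : v = ∑ i, v i • Pi.single i (1 : K) := by
    simpa [← Pi.single_smul] using (Finset.univ_sum_single v).symm
  have hpolar : QuadraticMap.polar Q v v =
      ∑ i, ∑ j, (v i * v j) • QuadraticMap.polar Q (Pi.single i 1) (Pi.single j 1) := by
    conv_lhs => rw [hv, ← QuadraticMap.polarBilin_apply_apply]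
    simp only [map_sum, LinearMap.sum_apply, map_smul, LinearMap.smul_apply, Finset.smul_sum,
      QuadraticMap.polarBilin_apply_apply, smul_smul]
    rw [Finset.sum_comm]
    simp only [mul_comm]
  simp only [veroneseLift, LinearMap.smul_apply, LinearMap.sum_apply, LinearMap.smulRight_apply,
    entryLinearMap_apply, vecMulVec_apply, ← hpolar, QuadraticMap.polar_self]
  rw [← Nat.cast_smul_eq_nsmul K, smul_smul, Nat.cast_ofNat, inv_mul_cancel₀ two_ne_zero, one_smul]

end Quadratic

section Sym3

theorem sym3_apply_comm (S : Sym3) (i j : Fin 3) : S.1 i j = S.1 j i :=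
  Matrix.IsSymm.apply S.2 j i

/-- The coordinates of a symmetric matrix in which the homogeneous equations of subsets of `ℙ⁵` are
written: all nine entries. -/
def entries : Sym3 →ₗ[ℂ] Fin 3 × Fin 3 → ℂ where
  toFun S ij := S.1 ij.1 ij.2
  map_add' _ _ := rfl
  map_smul' _ _ := rfl

theorem entries_apply (S : Sym3) (ij : Fin 3 × Fin 3) : entries S ij = S.1 ij.1 ij.2 := rfl

theorem entries_injective : Function.Injective entries := fun _ _ h =>
  Subtype.ext (Matrix.ext fun i j => congrFun h (i, j))

theorem exists_isHomogeneous_eval_entries_eq (φ : Sym3 →ₗ[ℂ] ℂ) :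
    ∃ f : MvPolynomial (Fin 3 × Fin 3) ℂ,
      f.IsHomogeneous 1 ∧ ∀ S, MvPolynomial.eval (entries S) f = φ S := by
  obtain ⟨g, hg⟩ := entries.exists_leftInverse_of_injective
    (LinearMap.ker_eq_bot.2 entries_injective)
  refine ⟨linearPolynomial (φ ∘ₗ g), linearPolynomial_isHomogeneous _, fun S => ?_⟩
  rw [eval_linearPolynomial, LinearMap.comp_apply]
  exact congrArg φ (LinearMap.congr_fun hg S)

/-- The adjugate of a symmetric `3 × 3` matrix, as a quadratic map on the space of conics. On
invertible matrices it represents the same point of `ℙ⁵` as the inverse. -/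
def adjSym : QuadraticMap ℂ Sym3 Sym3 :=
  QuadraticMap.ofPolar (fun S => ⟨S.1.adjugate, Matrix.IsSymm.adjugate S.2⟩)
    (fun c S => Subtype.ext (by simp [adjugate_smul, pow_two]))
    (fun S S' S'' => Subtype.ext (by
      ext i j
      fin_cases i <;> fin_cases j <;> simp [QuadraticMap.polar, adjugate_fin_three] <;> ring))
    (fun c S S' => Subtype.ext (by
      ext i j
      fin_cases i <;> fin_cases j <;> simp [QuadraticMap.polar, adjugate_fin_three] <;> ring))

theorem coe_adjSym (S : Sym3) : (adjSym S).1 = S.1.adjugate := rfl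

/-- The symmetric matrix `v vᵀ`, which represents the image of `v` in the Veronese surface. -/
def veronese (v : Fin 3 → ℂ) : Sym3 :=
  ⟨vecMulVec v v, show (vecMulVec v v)ᵀ = vecMulVec v v from transpose_vecMulVec v v⟩

theorem veronese_apply (v : Fin 3 → ℂ) (i j : Fin 3) : (veronese v).1 i j = v i * v j := rfl

theorem veronese_eq_conic (v : Fin 3 → ℂ) :
    veronese v = conic (v 0 ^ 2) (v 1 ^ 2) (v 2 ^ 2) (v 0 * v 1) (v 0 * v 2) (v 1 * v 2) := by
  apply Subtype.ext
  ext i j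
  fin_cases i <;> fin_cases j <;> simp [veronese, conic, vecMulVec_apply] <;> ring

theorem veronese_eq_zero_iff {v : Fin 3 → ℂ} : veronese v = 0 ↔ v = 0 :=
  Subtype.ext_iff.trans (vecMulVec_eq_zero.trans or_self_iff)

theorem mem_veroneseSurface {p : ProjSym3} : p ∈ veroneseSurface ↔
    ∃ v, ∃ hv : veronese v ≠ 0, p = Projectivization.mk ℂ (veronese v) hv := by
  constructor
  · rintro ⟨α, β, γ, -, h, rfl⟩
    refine ⟨![α, β, γ], ?_, ?_⟩ <;> simp only [veronese_eq_conic]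
    exacts [h, rfl]
  · rintro ⟨v, hv, rfl⟩
    have hne : v 0 ≠ 0 ∨ v 1 ≠ 0 ∨ v 2 ≠ 0 := by
      simpa [veronese_eq_zero_iff, funext_iff, Fin.forall_fin_succ, imp_iff_not_or] using hv
    refine ⟨v 0, v 1, v 2, hne, ?_, ?_⟩ <;> simp only [← veronese_eq_conic]
    exact hv

theorem exists_eq_veronese {S : Sym3}
    (hS : ∀ i j k l, S.1 i j * S.1 k l = S.1 i l * S.1 k j) : ∃ v, S = veronese v := by
  suffices ∃ v : Fin 3 → ℂ, ∀ i j, S.1 i j = v i * v j from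
    this.imp fun v hv => Subtype.ext (Matrix.ext hv)
  by_cases hdiag : ∀ i, S.1 i i = 0
  · refine ⟨0, fun i j => ?_⟩
    have hminor := hS i j j i
    rw [sym3_apply_comm S j i, hdiag i, zero_mul] at hminor
    rw [mul_self_eq_zero.1 hminor, Pi.zero_apply, zero_mul]
  · obtain ⟨k, hk⟩ := not_forall.1 hdiag
    obtain ⟨d, hd⟩ := IsAlgClosed.exists_eq_mul_self (S.1 k k)
    refine ⟨fun i => S.1 k i / d, fun i j => ?_⟩
    rw [div_mul_div_comm, ← hd, eq_div_iff hk, hS i j k k, sym3_apply_comm S i k]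

end Sym3

section Zariski

open MvPolynomial

theorem vanishesAt_mk {f : MvPolynomial (Fin 3 × Fin 3) ℂ} {d : ℕ} (hf : f.IsHomogeneous d)
    {M : Sym3} (hM : M ≠ 0) :
    VanishesAt f (Projectivization.mk ℂ M hM) ↔ eval (entries M) f = 0 := by
  refine ⟨fun h => h M hM rfl, fun h M' hM' hMM' => ?_⟩
  obtain ⟨c, rfl⟩ := (Projectivization.mk_eq_mk_iff' ℂ _ _ hM' hM).1 hMM'.symm
  change eval (entries (c • M)) f = 0
  rw [map_smul, eval_smul_of_isHomogeneous hf, h, mul_zero]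

theorem isZariskiClosed_veroneseSurface : IsZariskiClosed veroneseSurface := by
  have hhom (i j k l : Fin 3) : (X (i, j) * X (k, l) - X (i, l) * X (k, j) :
      MvPolynomial (Fin 3 × Fin 3) ℂ).IsHomogeneous (1 + 1) :=
    ((isHomogeneous_X _ _).mul (isHomogeneous_X _ _)).sub
      ((isHomogeneous_X _ _).mul (isHomogeneous_X _ _))
  refine ⟨{f | ∃ i j k l, f = X (i, j) * X (k, l) - X (i, l) * X (k, j)}, ?_, ?_⟩
  · rintro f ⟨i, j, k, l, rfl⟩
    exact ⟨_, hhom i j k l⟩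
  ext p
  induction p using Projectivization.ind with
  | h M hM =>
    constructor
    · rintro hp f ⟨i, j, k, l, rfl⟩
      obtain ⟨v, hv, hMv⟩ := mem_veroneseSurface.1 hp
      rw [hMv, vanishesAt_mk (hhom i j k l)]
      simp only [map_sub, map_mul, eval_X, entries_apply, veronese_apply]
      ring
    · intro hp
      obtain ⟨v, rfl⟩ : ∃ v, M = veronese v := exists_eq_veronese fun i j k l => by
        have hf := (vanishesAt_mk (hhom i j k l) hM).1 (hp _ ⟨i, j, k, l, rfl⟩)
        simpa [entries_apply, sub_eq_zero] using hf
      exact mem_veroneseSurface.2 ⟨v, hM, rfl⟩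

theorem projectivization_map_map_symm {K V W : Type*} [DivisionRing K] [AddCommGroup V]
    [Module K V] [AddCommGroup W] [Module K W] (T : V ≃ₗ[K] W) (p : ℙ K W) :
    Projectivization.map T.toLinearMap T.injective
      (Projectivization.map T.symm.toLinearMap T.symm.injective p) = p := by
  induction p using Projectivization.ind with
  | h M hM => simp [Projectivization.map_mk]

/-- Equations for the image are obtained by substituting `T⁻¹` into those of the original set. -/
theorem IsZariskiClosed.image {Z : Set ProjSym3} (hZ : IsZariskiClosed Z) (T : Sym3 ≃ₗ[ℂ] Sym3) :
    IsZariskiClosed (Projectivization.map T.toLinearMap T.injective '' Z) := by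
  obtain ⟨F, hF, rfl⟩ := hZ
  choose G hG hGeval using fun ij : Fin 3 × Fin 3 => exists_isHomogeneous_eval_entries_eq
    (LinearMap.proj ij ∘ₗ entries ∘ₗ T.symm.toLinearMap)
  have heval (f : MvPolynomial (Fin 3 × Fin 3) ℂ) (S : Sym3) :
      eval (entries (T S)) (aeval G f) = eval (entries S) f := by
    rw [← coe_aeval_eq_eval, ← coe_aeval_eq_eval, RingHom.coe_coe, RingHom.coe_coe,
      comp_aeval_apply]
    congr 2
    ext ij
    simp [hGeval]
  have hvanish {f d} (hf : f.IsHomogeneous d) (p : ProjSym3) :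
      VanishesAt (aeval G f) (Projectivization.map T.toLinearMap T.injective p) ↔
        VanishesAt f p := by
    induction p using Projectivization.ind with
    | h M hM =>
      rw [Projectivization.map_mk, vanishesAt_mk hf, vanishesAt_mk (hf.aeval G hG)]
      exact Eq.congr_left (heval f M)
  refine ⟨aeval G '' F, ?_, ?_⟩
  · rintro _ ⟨f, hf, rfl⟩
    exact (hF f hf).imp' _ fun d hd => hd.aeval G hG
  · ext p
    constructor
    · rintro ⟨q, hq, rfl⟩ _ ⟨f, hf, rfl⟩
      obtain ⟨d, hd⟩ := hF f hf
      exact (hvanish hd q).2 (hq f hf)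
    · intro hp
      rw [← projectivization_map_map_symm T p] at hp ⊢
      refine Set.mem_image_of_mem _ fun f hf => ?_
      obtain ⟨d, hd⟩ := hF f hf
      exact (hvanish hd _).1 (hp _ (Set.mem_image_of_mem _ hf))

end Zariski

section ReciprocalSurface

/-- The classes of the nonzero adjugates of the members of `L`: the image of the rational map
`[A] ↦ [adj A]` on `ℙ(L)`. -/
def adjugateLocus (L : Submodule ℂ Sym3) : Set ProjSym3 :=
  {p | ∃ A ∈ L, ∃ hA : adjSym A ≠ 0, p = Projectivization.mk ℂ (adjSym A) hA}

theorem inverseLocus_subset_adjugateLocus (L : Submodule ℂ Sym3) :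
    inverseLocus L ⊆ adjugateLocus L := by
  rintro p ⟨A, hAL, hdet, B, hB, hBA, rfl⟩
  have hadj : adjSym A = A.1.det • B := Subtype.ext <| by
    rw [Submodule.coe_smul, hBA, Matrix.inv_def, Ring.inverse_eq_inv', smul_inv_smul₀ hdet,
      coe_adjSym]
  have hne : adjSym A ≠ 0 := hadj ▸ smul_ne_zero hdet hB
  exact ⟨A, hAL, hne, (Projectivization.mk_eq_mk_iff' ℂ _ _ hB hne).2
    ⟨A.1.det⁻¹, by rw [hadj, inv_smul_smul₀ hdet]⟩⟩

theorem mk_adjSym_mem_inverseLocus {L : Submodule ℂ Sym3} {A : Sym3} (hA : A ∈ L)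
    (hdet : A.1.det ≠ 0) (hadj : adjSym A ≠ 0) :
    Projectivization.mk ℂ (adjSym A) hadj ∈ inverseLocus L := by
  have hne : A.1.det⁻¹ • adjSym A ≠ 0 := smul_ne_zero (inv_ne_zero hdet) hadj
  refine ⟨A, hA, hdet, _, hne, ?_, ?_⟩
  · rw [Submodule.coe_smul, Matrix.inv_def, Ring.inverse_eq_inv', coe_adjSym]
  · exact (Projectivization.mk_eq_mk_iff' ℂ _ _ hadj hne).2 ⟨A.1.det, smul_inv_smul₀ hdet _⟩

theorem adjSym_ne_zero_of_det_ne_zero {A : Sym3} (hA : A.1.det ≠ 0) : adjSym A ≠ 0 := fun h => by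
  have hdet := det_adjugate A.1
  rw [← coe_adjSym, h, Submodule.coe_zero, det_zero] at hdet
  exact pow_ne_zero _ hA hdet.symm

theorem adjugateLocus_subset_reciprocalSurface {L : Submodule ℂ Sym3}
    (hL : ∃ A ∈ L, A.1.det ≠ 0) : adjugateLocus L ⊆ reciprocalSurface L := by
  rintro _ ⟨A, hA, hadj, rfl⟩ _ ⟨⟨F, hF, rfl⟩, hsub⟩ f hf
  obtain ⟨A₀, hA₀, hdet⟩ := hL
  obtain ⟨d, hd⟩ := hF f hf
  refine (vanishesAt_mk hd hadj).2 (eval_adjugate_eq_zero hdet f fun t ht => ?_)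
  have hne : adjSym (A + t • A₀) ≠ 0 := adjSym_ne_zero_of_det_ne_zero ht
  exact (vanishesAt_mk hd hne).1
    (hsub (mk_adjSym_mem_inverseLocus (L.add_mem hA (L.smul_mem t hA₀)) ht hne) f hf)

theorem reciprocalSurface_eq_adjugateLocus {L : Submodule ℂ Sym3} (hL : ∃ A ∈ L, A.1.det ≠ 0)
    (hclosed : IsZariskiClosed (adjugateLocus L)) : reciprocalSurface L = adjugateLocus L :=
  Set.Subset.antisymm (Set.sInter_subset_of_mem ⟨hclosed, inverseLocus_subset_adjugateLocus L⟩)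
    (adjugateLocus_subset_reciprocalSurface hL)

/-- The condition under which the quadratic map `A ↦ adj A` on `L` is the full second Veronese
embedding, rather than one of its projections. -/
def AdjugatesSpan (L : Submodule ℂ Sym3) : Prop :=
  Submodule.span ℂ (adjSym '' L) = ⊤

theorem adjugatesSpan_of_forall_linearMap {L : Submodule ℂ Sym3}
    (h : ∀ φ : Sym3 →ₗ[ℂ] ℂ, (∀ A ∈ L, φ (adjSym A) = 0) → φ = 0) : AdjugatesSpan L := by
  by_contra hne
  obtain ⟨φ, hφ, hle⟩ := Submodule.exists_le_ker_of_lt_top _ (lt_top_iff_ne_top.2 hne)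
  exact hφ (h φ fun A hA => hle (Submodule.subset_span ⟨A, hA, rfl⟩))

theorem IsNet.nonempty_linearEquiv {L : Submodule ℂ Sym3} (hL : IsNet L) :
    Nonempty ((Fin 3 → ℂ) ≃ₗ[ℂ] L) := by
  have : Module.Free ℂ L := Module.Free.of_divisionRing ℂ L
  have : Module.Finite ℂ L := Module.finite_of_finrank_pos (by rw [hL]; norm_num)
  exact ⟨LinearEquiv.ofFinrankEq _ _ (by rw [hL]; simp)⟩

theorem exists_linearEquiv_veronese {L : Submodule ℂ Sym3} (hL : IsNet L)
    (hspan : AdjugatesSpan L) : ∃ (e : (Fin 3 → ℂ) ≃ₗ[ℂ] L) (T : Sym3 ≃ₗ[ℂ] Sym3),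
      ∀ x, T (veronese x) = adjSym (e x) := by
  obtain ⟨e⟩ := hL.nonempty_linearEquiv
  let T := veroneseLift (adjSym.comp (L.subtype ∘ₗ e.toLinearMap)) ∘ₗ Sym3.subtype
  have hT (x : Fin 3 → ℂ) : T (veronese x) = adjSym (e x) := veroneseLift_vecMulVec _ x
  have hsurj : Function.Surjective T := by
    rw [← LinearMap.range_eq_top, ← top_le_iff, ← hspan, Submodule.span_le]
    rintro _ ⟨A, hA, rfl⟩
    exact ⟨veronese (e.symm ⟨A, hA⟩), by rw [hT, e.apply_symm_apply]⟩
  exact ⟨e, LinearEquiv.ofBijective T ⟨LinearMap.injective_iff_surjective.2 hsurj, hsurj⟩, hT⟩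

theorem adjugateLocus_eq_image_veroneseSurface {L : Submodule ℂ Sym3}
    (e : (Fin 3 → ℂ) ≃ₗ[ℂ] L) {T : Sym3 ≃ₗ[ℂ] Sym3} (hT : ∀ x, T (veronese x) = adjSym (e x)) :
    adjugateLocus L = Projectivization.map T.toLinearMap T.injective '' veroneseSurface := by
  ext p
  constructor
  · rintro ⟨A, hA, hadj, rfl⟩
    have hx : T (veronese (e.symm ⟨A, hA⟩)) = adjSym A := by rw [hT, e.apply_symm_apply]
    have hx0 : veronese (e.symm ⟨A, hA⟩) ≠ 0 := fun h => hadj (by rw [← hx, h, map_zero])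
    refine ⟨_, mem_veroneseSurface.2 ⟨_, hx0, rfl⟩, ?_⟩
    simp only [Projectivization.map_mk, LinearEquiv.coe_coe, hx]
  · rintro ⟨_, hq, rfl⟩
    obtain ⟨x, hx, rfl⟩ := mem_veroneseSurface.1 hq
    refine ⟨e x, (e x).2, hT x ▸ T.map_ne_zero_iff.2 hx, ?_⟩
    simp only [Projectivization.map_mk, LinearEquiv.coe_coe, hT]

theorem projectivelyEquivalent_image_self (T : Sym3 ≃ₗ[ℂ] Sym3) (X : Set ProjSym3) :
    ProjectivelyEquivalent (Projectivization.map T.toLinearMap T.injective '' X) X := by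
  refine ⟨T.symm, ?_⟩
  rw [Set.image_image]
  exact (Set.image_congr fun p _ => projectivization_map_map_symm T.symm p).trans
    (Set.image_id' X)

theorem projectivelyEquivalent_veroneseSurface_of_adjugatesSpan {L : Submodule ℂ Sym3}
    (hL : IsNet L) (hdet : ∃ A ∈ L, A.1.det ≠ 0) (hspan : AdjugatesSpan L) :
    ProjectivelyEquivalent (reciprocalSurface L) veroneseSurface := by
  obtain ⟨e, T, hT⟩ := exists_linearEquiv_veronese hL hspan
  have himage := adjugateLocus_eq_image_veroneseSurface e hT
  have hclosed : IsZariskiClosed (adjugateLocus L) :=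
    himage ▸ isZariskiClosed_veroneseSurface.image T
  rw [reciprocalSurface_eq_adjugateLocus hdet hclosed, himage]
  exact projectivelyEquivalent_image_self T veroneseSurface

end ReciprocalSurface

section Coordinates

theorem coeffs_eq_zero_of_forall_eq_zero {K : Type*} [CommRing K] {a b c d e f : K}
    (h : ∀ x y z : K, a * x ^ 2 + b * y ^ 2 + c * z ^ 2 + d * (x * y) + e * (x * z) + f * (y * z)
      = 0) : a = 0 ∧ b = 0 ∧ c = 0 ∧ d = 0 ∧ e = 0 ∧ f = 0 := by
  have ha : a = 0 := by simpa using h 1 0 0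
  have hb : b = 0 := by simpa using h 0 1 0
  have hc : c = 0 := by simpa using h 0 0 1
  subst ha hb hc
  exact ⟨rfl, rfl, rfl, by simpa using h 1 1 0, by simpa using h 1 0 1, by simpa using h 0 1 1⟩

theorem sym3_eq_conic (S : Sym3) :
    S = conic (S.1 0 0) (S.1 1 1) (S.1 2 2) (S.1 0 1) (S.1 0 2) (S.1 1 2) := by
  apply Subtype.ext
  ext i j
  fin_cases i <;> fin_cases j <;> simp [conic, sym3_apply_comm S _ 0, sym3_apply_comm S 2 1]

theorem eq_zero_of_forall_map_conic {φ : Sym3 →ₗ[ℂ] ℂ}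
    (h : ∀ a b c d e f, φ (conic a b c d e f) = 0) : φ = 0 :=
  LinearMap.ext fun S => sym3_eq_conic S ▸ h ..

theorem exists_forall_map_conic_eq (φ : Sym3 →ₗ[ℂ] ℂ) : ∃ p q r s t u : ℂ, ∀ a b c d e f,
    φ (conic a b c d e f) = a * p + b * q + c * r + d * s + e * t + f * u := by
  refine ⟨φ (conic 1 0 0 0 0 0), φ (conic 0 1 0 0 0 0), φ (conic 0 0 1 0 0 0),
    φ (conic 0 0 0 1 0 0), φ (conic 0 0 0 0 1 0), φ (conic 0 0 0 0 0 1), fun a b c d e f => ?_⟩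
  have hsum : conic a b c d e f = a • conic 1 0 0 0 0 0 + b • conic 0 1 0 0 0 0 +
      c • conic 0 0 1 0 0 0 + d • conic 0 0 0 1 0 0 + e • conic 0 0 0 0 1 0 +
      f • conic 0 0 0 0 0 1 := by
    apply Subtype.ext
    ext i j
    fin_cases i <;> fin_cases j <;> simp [conic]
  simp only [hsum, map_add, map_smul, smul_eq_mul]

theorem eq_zero_of_map_veronese {φ : Sym3 →ₗ[ℂ] ℂ} (h : ∀ v, φ (veronese v) = 0) : φ = 0 := by
  obtain ⟨p, q, r, s, t, u, hφ⟩ := exists_forall_map_conic_eq φ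
  simp only [veronese_eq_conic, hφ] at h
  obtain ⟨rfl, rfl, rfl, rfl, rfl, rfl⟩ := coeffs_eq_zero_of_forall_eq_zero
    (a := p) (b := q) (c := r) (d := s) (e := t) (f := u) fun x y z => by
      have hv := h ![x, y, z]
      simp only [cons_val] at hv
      linear_combination hv
  exact eq_zero_of_forall_map_conic fun a b c d e f => by simp [hφ]

end Coordinates

section Jacobian

/-- The hypersurface `det N = 0` in the projective space of parameters of a linear family `N` of
matrices is smooth. The derivative of `det N` at `x` along `y` is written by Jacobi's formula. -/
def SmoothDeterminant {K σ n : Type*} [Field K] [Fintype n] [DecidableEq n]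
    (N : (σ → K) →ₗ[K] Matrix n n K) : Prop :=
  ∀ x ≠ 0, (N x).det = 0 → ∃ y, ((N x).adjugate * N y).trace ≠ 0

theorem SmoothDeterminant.squarefree {K σ n : Type*} [Field K] [IsAlgClosed K] [Fintype σ]
    [DecidableEq σ] [Nontrivial σ] [Fintype n] [DecidableEq n] {N : (σ → K) →ₗ[K] Matrix n n K}
    (hN : SmoothDeterminant N) : Squarefree (genericMatrix N).det := by
  refine squarefree_of_exists_pderiv_ne_zero fun x hx hdet => ?_
  rw [eval_det_genericMatrix] at hdet
  simp only [eval_pderiv_det_genericMatrix]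
  obtain ⟨y, hy⟩ := hN x hx hdet
  by_contra! hsing
  let D : (σ → K) →ₗ[K] K :=
    traceLinearMap n K K ∘ₗ LinearMap.mulLeft K (N x).adjugate ∘ₗ N
  have hD : D = 0 := LinearMap.pi_ext' fun i => LinearMap.ext_ring (hsing i)
  exact hy (LinearMap.congr_fun hD y)

theorem eq_zero_of_forall_det_eq_zero {N : (Fin 3 → ℂ) →ₗ[ℂ] Matrix (Fin 3) (Fin 3) ℂ}
    (hN : SmoothDeterminant N) {φ : Sym3 →ₗ[ℂ] ℂ}
    (hφ : ∀ v ≠ 0, (N v).det = 0 → φ (veronese v) = 0) : φ = 0 := by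
  obtain ⟨f, hf, hfeval⟩ := exists_isHomogeneous_eval_entries_eq φ
  let q : MvPolynomial (Fin 3) ℂ :=
    MvPolynomial.aeval (fun ij : Fin 3 × Fin 3 => MvPolynomial.X ij.1 * MvPolynomial.X ij.2) f
  have hq : q.IsHomogeneous (2 * 1) := hf.aeval _ fun ij =>
    (MvPolynomial.isHomogeneous_X ℂ ij.1).mul (MvPolynomial.isHomogeneous_X ℂ ij.2)
  have hqeval (v : Fin 3 → ℂ) : MvPolynomial.eval v q = φ (veronese v) := by
    rw [← hfeval, ← MvPolynomial.coe_aeval_eq_eval, ← MvPolynomial.coe_aeval_eq_eval,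
      RingHom.coe_coe, RingHom.coe_coe, MvPolynomial.comp_aeval_apply]
    congr 2
    ext ij
    simp [entries_apply, veronese_apply]
  have hdvd : (genericMatrix N).det ∣ q :=
    dvd_of_squarefree_of_forall_eval_eq_zero hN.squarefree fun v hv => by
      rw [eval_det_genericMatrix] at hv
      rw [hqeval]
      rcases eq_or_ne v 0 with rfl | hv0
      · rw [veronese_eq_zero_iff.2 rfl, map_zero]
      · exact hφ v hv0 hv
  have hq0 : q = 0 :=
    eq_zero_of_isHomogeneous_of_dvd (det_genericMatrix_isHomogeneous N) hq (by simp) hdvd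
  exact eq_zero_of_map_veronese fun v => by rw [← hqeval, hq0, map_zero]

/-- The Jacobian matrix, up to the factor `2`, at the point `v` of three conics: its columns are the
vectors `P eₖ *ᵥ v`. Its determinant is the equation of the Jacobian cubic, the locus of the kernels
of the singular members of the net. -/
noncomputable def jacobianMatrix (P : (Fin 3 → ℂ) →ₗ[ℂ] Sym3) :
    (Fin 3 → ℂ) →ₗ[ℂ] Matrix (Fin 3) (Fin 3) ℂ :=
  LinearMap.toMatrix'.toLinearMap ∘ₗ (toLin'.toLinearMap ∘ₗ Sym3.subtype ∘ₗ P).flip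

theorem jacobianMatrix_mulVec (P : (Fin 3 → ℂ) →ₗ[ℂ] Sym3) (v x : Fin 3 → ℂ) :
    jacobianMatrix P v *ᵥ x = (P x).1 *ᵥ v :=
  LinearMap.toMatrix'_mulVec _ _

theorem trace_vecMulVec_mul {R n : Type*} [CommSemiring R] [Fintype n] (v w : n → R)
    (M : Matrix n n R) : (vecMulVec v w * M).trace = w ⬝ᵥ M *ᵥ v := by
  rw [vecMulVec_mul, trace_vecMulVec, dotProduct_comm, dotProduct_mulVec]

variable {P : (Fin 3 → ℂ) →ₗ[ℂ] Sym3} {v x : Fin 3 → ℂ}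

theorem exists_adjSym_eq_smul_veronese (hP : SmoothDeterminant (Sym3.subtype ∘ₗ P)) (hv : v ≠ 0)
    (hx : x ≠ 0) (hJx : jacobianMatrix P v *ᵥ x = 0) :
    ∃ c : ℂ, c ≠ 0 ∧ adjSym (P x) = c • veronese v ∧ ∃ y, v ⬝ᵥ (P y).1 *ᵥ v ≠ 0 := by
  rw [jacobianMatrix_mulVec] at hJx
  obtain ⟨c, hc⟩ := exists_adjugate_eq_smul_vecMulVec (P x).2 hv hJx
  obtain ⟨y, hy⟩ := hP x hx (exists_mulVec_eq_zero_iff.1 ⟨v, hv, hJx⟩)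
  have htrace : ((P x).1.adjugate * (P y).1).trace = c * (v ⬝ᵥ (P y).1 *ᵥ v) := by
    rw [hc, smul_mul_assoc, trace_smul, trace_vecMulVec_mul, smul_eq_mul]
  have hne : c * (v ⬝ᵥ (P y).1 *ᵥ v) ≠ 0 := htrace ▸ hy
  exact ⟨c, left_ne_zero_of_mul hne, Subtype.ext hc, y, right_ne_zero_of_mul hne⟩

/-- Otherwise a whole line of members of the net is singular at `v`, and one of these members has
rank one, so is a singular point of the discriminant. -/
theorem adjugate_jacobianMatrix_ne_zero (hP : SmoothDeterminant (Sym3.subtype ∘ₗ P))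
    (hv : v ≠ 0) : (jacobianMatrix P v).adjugate ≠ 0 := by
  intro hadj
  obtain ⟨x, hx, hJx, -⟩ := exists_mulVec_eq_zero_of_adjugate_eq_zero hadj 0
  obtain ⟨i, hxi⟩ : ∃ i, x i ≠ 0 := Function.ne_iff.1 hx
  obtain ⟨x', hx', hJx', hx'i⟩ := exists_mulVec_eq_zero_of_adjugate_eq_zero hadj i
  obtain ⟨j, hvj⟩ := Function.ne_iff.1 hv
  let Q : QuadraticForm ℂ (Fin 3 → ℂ) :=
    (entryLinearMap ℂ ℂ j j ∘ₗ Sym3.subtype).compQuadraticMap (adjSym.comp P)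
  have hQ {z : Fin 3 → ℂ} (hz : z ≠ 0) (hJz : jacobianMatrix P v *ᵥ z = 0) : Q z ≠ 0 := by
    obtain ⟨c, hc, hadjz, -⟩ := exists_adjSym_eq_smul_veronese hP hv hz hJz
    have hQz : Q z = c * (v j * v j) := congrArg (fun S : Sym3 => S.1 j j) hadjz
    exact hQz ▸ mul_ne_zero hc (mul_self_ne_zero.2 hvj)
  obtain ⟨s, hs⟩ := exists_quadraticMap_add_smul_eq_zero Q (hQ hx hJx) x'
  refine hQ ?_ (by rw [mulVec_add, mulVec_smul, hJx, hJx', smul_zero, add_zero]) hs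
  intro hz
  have hs0 : s = 0 := by simpa [hx'i, hxi] using congrFun hz i
  exact hx' (by simpa [hs0] using hz)

theorem smoothDeterminant_jacobianMatrix (hP : SmoothDeterminant (Sym3.subtype ∘ₗ P)) :
    SmoothDeterminant (jacobianMatrix P) := by
  intro v hv hdet
  by_contra! hsing
  have hadj := adjugate_jacobianMatrix_ne_zero hP hv
  obtain ⟨x, hx, hJx⟩ := exists_mulVec_eq_zero_iff.2 hdet
  obtain ⟨c, hc, hadjx, y, hy⟩ := exists_adjSym_eq_smul_veronese hP hv hx hJx
  obtain ⟨r, hr⟩ := exists_adjugate_eq_vecMulVec hx hJx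
  have hPxr : (P x).1 *ᵥ r = 0 := by
    have hrP : r ᵥ* (P x).1 = 0 := dotProduct_eq_zero _ fun w => by
      rw [← dotProduct_mulVec, ← jacobianMatrix_mulVec, ← trace_vecMulVec_mul, ← hr, hsing]
    rwa [← mulVec_transpose, Matrix.IsSymm.eq (P x).2] at hrP
  obtain ⟨d, rfl⟩ : ∃ d : ℂ, r = d • v := by
    refine exists_eq_smul_of_mulVec_eq_zero (M := (P x).1) ?_ hv
      ((jacobianMatrix_mulVec P v x).symm.trans hJx) hPxr
    rw [← coe_adjSym, hadjx]
    exact Subtype.coe_ne_coe.2 (smul_ne_zero hc (veronese_eq_zero_iff.not.2 hv))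
  have hd : d ≠ 0 := by
    rintro rfl
    exact hadj (by rw [hr, zero_smul, vecMulVec_zero])
  have hvJ : v ᵥ* jacobianMatrix P v = 0 := by
    have hmul := adjugate_mul (jacobianMatrix P v)
    rw [hr, hdet, zero_smul, vecMulVec_mul, vecMulVec_eq_zero, smul_vecMul] at hmul
    exact (smul_eq_zero.1 (hmul.resolve_left hx)).resolve_left hd
  exact hy (by rw [← jacobianMatrix_mulVec, dotProduct_mulVec, hvJ, zero_dotProduct])

end Jacobian

section TypeA

variable {L : Submodule ℂ Sym3}

theorem SmoothDiscriminant.exists_det_ne_zero (hL : SmoothDiscriminant L) (hne : L ≠ ⊥) :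
    ∃ A ∈ L, A.1.det ≠ 0 := by
  by_contra! hdet
  obtain ⟨A, hA, hA0⟩ := L.exists_mem_ne_zero_of_ne_bot hne
  obtain ⟨B, hB, hderiv⟩ := hL A hA hA0 (hdet A hA)
  refine hderiv ?_
  simp_rw [hdet _ (L.add_mem hA (L.smul_mem _ hB)), deriv_const]

theorem SmoothDiscriminant.smoothDeterminant (hL : SmoothDiscriminant L)
    {σ : Type*} (e : (σ → ℂ) ≃ₗ[ℂ] L) :
    SmoothDeterminant (Sym3.subtype ∘ₗ L.subtype ∘ₗ e.toLinearMap) := by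
  intro x hx hdet
  obtain ⟨B, hB, hderiv⟩ := hL (e x) (e x).2 (by simpa using hx) hdet
  refine ⟨e.symm ⟨B, hB⟩, ?_⟩
  have hBe : (Sym3.subtype ∘ₗ L.subtype ∘ₗ e.toLinearMap) (e.symm ⟨B, hB⟩) = B.1 := by simp
  rw [hBe]
  exact (deriv_det_add_smul _ _).symm.trans_ne hderiv

theorem SmoothDiscriminant.adjugatesSpan (hsm : SmoothDiscriminant L) (hL : IsNet L) :
    AdjugatesSpan L := by
  refine adjugatesSpan_of_forall_linearMap fun φ hφ => ?_
  obtain ⟨e⟩ := hL.nonempty_linearEquiv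
  have hP := hsm.smoothDeterminant e
  refine eq_zero_of_forall_det_eq_zero (smoothDeterminant_jacobianMatrix hP) fun v hv hdet => ?_
  obtain ⟨x, hx, hJx⟩ := exists_mulVec_eq_zero_iff.2 hdet
  obtain ⟨c, hc, hadj, -⟩ := exists_adjSym_eq_smul_veronese hP hv hx hJx
  have hφc : c • φ (veronese v) = 0 := by rw [← map_smul, ← hadj]; exact hφ _ (e x).2
  exact (smul_eq_zero.1 hφc).resolve_left hc

theorem projectivelyEquivalent_of_isTypeA (hA : IsTypeA L) :
    ProjectivelyEquivalent (reciprocalSurface L) veroneseSurface := by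
  obtain ⟨hL, hsm⟩ := hA
  have hne : L ≠ ⊥ := by
    rintro rfl
    simp [IsNet] at hL
  exact projectivelyEquivalent_veroneseSurface_of_adjugatesSpan hL (hsm.exists_det_ne_zero hne)
    (hsm.adjugatesSpan hL)

end TypeA

section Congruence

/-- The congruence `S ↦ h S hᵀ` on the space of symmetric matrices. -/
def congruence (h : Matrix (Fin 3) (Fin 3) ℂ) : Sym3 →ₗ[ℂ] Sym3 where
  toFun S := ⟨h * S.1 * hᵀ, show (h * S.1 * hᵀ)ᵀ = h * S.1 * hᵀ by
    rw [transpose_mul, transpose_mul, transpose_transpose, Matrix.IsSymm.eq S.2, mul_assoc]⟩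
  map_add' S S' := Subtype.ext (by simp [mul_add, add_mul])
  map_smul' c S := Subtype.ext (by simp)

theorem coe_congruence (h : Matrix (Fin 3) (Fin 3) ℂ) (S : Sym3) :
    (congruence h S).1 = h * S.1 * hᵀ := rfl

theorem adjSym_congruence (h : Matrix (Fin 3) (Fin 3) ℂ) (S : Sym3) :
    adjSym (congruence h S) = congruence hᵀ.adjugate (adjSym S) := by
  apply Subtype.ext
  simp only [coe_adjSym, coe_congruence, adjugate_mul_distrib, ← adjugate_transpose,
    transpose_transpose, mul_assoc]

theorem det_congruence (h : Matrix (Fin 3) (Fin 3) ℂ) (S : Sym3) :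
    (congruence h S).1.det = h.det ^ 2 * S.1.det := by
  rw [coe_congruence, det_mul, det_mul, det_transpose]
  ring

theorem congruence_surjective {h : Matrix (Fin 3) (Fin 3) ℂ} (hh : IsUnit h.det) :
    Function.Surjective (congruence h) := fun S => by
  refine ⟨congruence h⁻¹ S, Subtype.ext ?_⟩
  calc h * (h⁻¹ * S.1 * h⁻¹ᵀ) * hᵀ = (h * h⁻¹) * S.1 * (h * h⁻¹)ᵀ := by
        simp only [transpose_mul, mul_assoc]
    _ = S.1 := by rw [mul_nonsing_inv h hh, transpose_one, one_mul, mul_one]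

variable {L₀ L : Submodule ℂ Sym3}

theorem Congruent.exists_congruence_mem (hcong : Congruent L₀ L) :
    ∃ h : Matrix (Fin 3) (Fin 3) ℂ, IsUnit h.det ∧ ∀ A ∈ L₀, congruence h A ∈ L := by
  obtain ⟨g, hg⟩ := hcong
  refine ⟨g.1ᵀ, ?_, fun A hA => (hg _).2 ⟨A, hA, ?_⟩⟩
  · rw [det_transpose]
    exact g.1.isUnit_iff_isUnit_det.1 g.isUnit
  · rw [coe_congruence, transpose_transpose]

theorem Congruent.exists_det_ne_zero (hcong : Congruent L₀ L) (hdet : ∃ A ∈ L₀, A.1.det ≠ 0) :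
    ∃ A ∈ L, A.1.det ≠ 0 := by
  obtain ⟨h, hh, hmem⟩ := hcong.exists_congruence_mem
  obtain ⟨A, hA, hA0⟩ := hdet
  refine ⟨_, hmem A hA, ?_⟩
  rw [det_congruence]
  exact mul_ne_zero (pow_ne_zero 2 hh.ne_zero) hA0

theorem Congruent.adjugatesSpan (hcong : Congruent L₀ L) (hspan : AdjugatesSpan L₀) :
    AdjugatesSpan L := by
  obtain ⟨h, hh, hmem⟩ := hcong.exists_congruence_mem
  have hadj : IsUnit hᵀ.adjugate.det := by
    rw [det_adjugate, det_transpose]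
    exact hh.pow _
  rw [AdjugatesSpan, ← top_le_iff,
    ← LinearMap.range_eq_top.2 (congruence_surjective hadj), LinearMap.range_eq_map, ← hspan,
    Submodule.map_span]
  refine Submodule.span_mono ?_
  rintro _ ⟨_, ⟨A, hA, rfl⟩, rfl⟩
  exact ⟨congruence h A, hmem A hA, adjSym_congruence h A⟩

theorem projectivelyEquivalent_of_congruent (hL : IsNet L) (hcong : Congruent L₀ L)
    (hdet : ∃ A ∈ L₀, A.1.det ≠ 0) (hspan : AdjugatesSpan L₀) :
    ProjectivelyEquivalent (reciprocalSurface L) veroneseSurface :=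
  projectivelyEquivalent_veroneseSurface_of_adjugatesSpan hL (hcong.exists_det_ne_zero hdet)
    (hcong.adjugatesSpan hspan)

end Congruence

section NormalForms

theorem adjSym_conic (a b c d e f : ℂ) : adjSym (conic a b c d e f) =
    conic (b * c - f ^ 2) (a * c - e ^ 2) (a * b - d ^ 2) (e * f - c * d) (d * f - b * e)
      (d * e - a * f) := by
  apply Subtype.ext
  ext i j
  simp only [coe_adjSym, conic, adjugate_fin_three]
  fin_cases i <;> fin_cases j <;> simp <;> ring

theorem det_conic (a b c d e f : ℂ) :
    (conic a b c d e f).1.det = a * b * c + 2 * d * e * f - a * f ^ 2 - b * e ^ 2 - c * d ^ 2 := by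
  simp only [conic, det_fin_three, of_apply, cons_val]
  ring

variable {L : Submodule ℂ Sym3}

theorem conic_mem_span_bStar (x y z : ℂ) : conic (-z) (x - 2 * z) 0 0 (x + z) y ∈
    Submodule.span ℂ {conic 0 1 0 0 1 0, conic 0 0 0 0 0 1, conic (-1) (-2) 0 0 1 0} := by
  refine Submodule.mem_span_triple.2 ⟨x, y, z, Subtype.ext ?_⟩
  ext i j
  fin_cases i <;> fin_cases j <;> simp [conic, sub_eq_add_neg, mul_comm z]

theorem adjugatesSpan_bStar : AdjugatesSpan (Submodule.span ℂ
    {conic 0 1 0 0 1 0, conic 0 0 0 0 0 1, conic (-1) (-2) 0 0 1 0}) := by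
  refine adjugatesSpan_of_forall_linearMap fun φ hφ => ?_
  obtain ⟨p, q, r, s, t, u, hφeq⟩ := exists_forall_map_conic_eq φ
  have h (x y z : ℂ) := hφ _ (conic_mem_span_bStar x y z)
  simp only [adjSym_conic, hφeq] at h
  obtain ⟨hx, hy, hz, hxy, hxz, hyz⟩ := coeffs_eq_zero_of_forall_eq_zero (a := -q - t) (b := -p)
    (c := -q + 2 * r + 2 * t) (d := s) (e := -2 * q - r + t) (f := s + u)
    fun x y z => by linear_combination h x y z
  exact eq_zero_of_forall_map_conic fun a b c d e f => by rw [hφeq]; grind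

theorem projectivelyEquivalent_of_isTypeBStar (hL : IsNet L) (hB : IsTypeBStar L) :
    ProjectivelyEquivalent (reciprocalSurface L) veroneseSurface :=
  projectivelyEquivalent_of_congruent hL hB
    ⟨_, conic_mem_span_bStar 1 0 0, by rw [det_conic]; norm_num⟩ adjugatesSpan_bStar

theorem conic_mem_span_dStar (x y z : ℂ) : conic 0 0 z z x y ∈
    Submodule.span ℂ {conic 0 0 0 0 1 0, conic 0 0 0 0 0 1, conic 0 0 1 1 0 0} := by
  refine Submodule.mem_span_triple.2 ⟨x, y, z, Subtype.ext ?_⟩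
  ext i j
  fin_cases i <;> fin_cases j <;> simp [conic]

theorem adjugatesSpan_dStar : AdjugatesSpan (Submodule.span ℂ
    {conic 0 0 0 0 1 0, conic 0 0 0 0 0 1, conic 0 0 1 1 0 0}) := by
  refine adjugatesSpan_of_forall_linearMap fun φ hφ => ?_
  obtain ⟨p, q, r, s, t, u, hφeq⟩ := exists_forall_map_conic_eq φ
  have h (x y z : ℂ) := hφ _ (conic_mem_span_dStar x y z)
  simp only [adjSym_conic, hφeq] at h
  obtain ⟨hx, hy, hz, hxy, hxz, hyz⟩ := coeffs_eq_zero_of_forall_eq_zero (a := -q) (b := -p)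
    (c := -r - s) (d := s) (e := u) (f := t) fun x y z => by linear_combination h x y z
  exact eq_zero_of_forall_map_conic fun a b c d e f => by rw [hφeq]; grind

theorem projectivelyEquivalent_of_isTypeDStar (hL : IsNet L) (hD : IsTypeDStar L) :
    ProjectivelyEquivalent (reciprocalSurface L) veroneseSurface :=
  projectivelyEquivalent_of_congruent hL hD
    ⟨_, conic_mem_span_dStar 0 1 1, by rw [det_conic]; norm_num⟩ adjugatesSpan_dStar

theorem conic_mem_span_eStar (x y z : ℂ) : conic 0 0 0 z x y ∈
    Submodule.span ℂ {conic 0 0 0 0 1 0, conic 0 0 0 0 0 1, conic 0 0 0 1 0 0} := by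
  refine Submodule.mem_span_triple.2 ⟨x, y, z, Subtype.ext ?_⟩
  ext i j
  fin_cases i <;> fin_cases j <;> simp [conic]

theorem adjugatesSpan_eStar : AdjugatesSpan (Submodule.span ℂ
    {conic 0 0 0 0 1 0, conic 0 0 0 0 0 1, conic 0 0 0 1 0 0}) := by
  refine adjugatesSpan_of_forall_linearMap fun φ hφ => ?_
  obtain ⟨p, q, r, s, t, u, hφeq⟩ := exists_forall_map_conic_eq φ
  have h (x y z : ℂ) := hφ _ (conic_mem_span_eStar x y z)
  simp only [adjSym_conic, hφeq] at h
  obtain ⟨hx, hy, hz, hxy, hxz, hyz⟩ := coeffs_eq_zero_of_forall_eq_zero (a := -q) (b := -p)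
    (c := -r) (d := s) (e := u) (f := t) fun x y z => by linear_combination h x y z
  exact eq_zero_of_forall_map_conic fun a b c d e f => by rw [hφeq]; grind

theorem projectivelyEquivalent_of_isTypeEStar (hL : IsNet L) (hE : IsTypeEStar L) :
    ProjectivelyEquivalent (reciprocalSurface L) veroneseSurface :=
  projectivelyEquivalent_of_congruent hL hE
    ⟨_, conic_mem_span_eStar 1 1 1, by rw [det_conic]; norm_num⟩ adjugatesSpan_eStar

end NormalForms

end NetsOfConics

theorem theorem3p2 (L : Submodule ℂ NetsOfConics.Sym3) (hL : NetsOfConics.IsNet L)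
    (hType : NetsOfConics.IsTypeA L ∨ NetsOfConics.IsTypeBStar L ∨
      NetsOfConics.IsTypeDStar L ∨ NetsOfConics.IsTypeEStar L) :
    NetsOfConics.ProjectivelyEquivalent (NetsOfConics.reciprocalSurface L)
      NetsOfConics.veroneseSurface := by
  rcases hType with hA | hB | hD | hE
  · exact NetsOfConics.projectivelyEquivalent_of_isTypeA hA
  · exact NetsOfConics.projectivelyEquivalent_of_isTypeBStar hL hB
  · exact NetsOfConics.projectivelyEquivalent_of_isTypeDStar hL hD
  · exact NetsOfConics.projectivelyEquivalent_of_isTypeEStar hL hE
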